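/- All manifolds are smooth, finite-dimensional, Hausdorff and without boundary (they may be empty). A relation $f\colon X\leftarrow Y$ to $X$ from $Y$ is a subset of $X\times Y$; its transpose is $f^{\mathrm t}\subseteq Y\times X$, and $f\circ g=\{(x,z) : (x,y)\in f \text{ and } (y,z)\in g \text{ for some } y\}$. It is surjective if every $x\in X$ lies in some $(x,y)\in f$, and coinjective if for every $y\in Y$ there is at most one $(x,y)\in f$. A relation between manifolds is smooth if it is a closed submanifold of $X\times Y$; its differential $Tf\colon TX\leftarrow TY$ is its tangent bundle. A smooth relation $f\colon X\leftarrow Y$ is a reduction if $f$ and $Tf$ are surjective and coinjective and the projection $f\to Y$ is proper; it is a coreduction if $f^{\mathrm t}$ is a reduction. A pair of smooth relations $f\colon X\leftarrow Y$, $g\colon Y\leftarrow Z$ is strongly transversal if $f\times g$ is transversal to $X\times\Delta_Y\times Z$ in $X\times Y\times Y\times Z$ and the projection to $X\times Z$ of the fibre product $f\times_Y g=(f\times g)\cap(X\times\Delta_Y\times Z)$ is an embedding onto a closed submanifold. For a symplectic manifold $Y=(Y,\omega_Y)$ put $\overline Y=(Y,-\omega_Y)$. A canonical relation $f\colon X\leftarrow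 Y$ between symplectic manifolds is a smooth relation that is lagrangian as a submanifold of $X\times\overline Y$. Let $\mathbf 1$ be the one-point manifold, $1_X$ the identity relation (the diagonal) of $X$, $\epsilon_Y\colon \mathbf 1\leftarrow\overline Y\times Y$ the diagonal of $Y$, and $\gamma_f\colon X\times\overline Y\leftarrow\mathbf 1$ the set $f$ itself, viewed as a relation from the point. Proposition. Let $X$, $Y$ be symplectic manifolds and $f\colon X\leftarrow Y$ a canonical relation. Then $X\times\overline Y\times Y$ is a symplectic manifold, and $f$ is the composition $f=(1_X\times\epsilon_Y)\circ(\gamma_f\times 1_Y)$ of the canonical relations $$X = X\times\mathbf 1 \xleftarrow{\;1_X\times\epsilon_Y\;} X\times\overline Y\times Y \xleftarrow{\;\gamma_f\times 1_Y\;} \mathbf 1\times Y = Y .$$ The pair $(1_X\times\epsilon_Y,\ \gamma_f\times 1_Y)$ is strongly transversal. The relation $1_X\times\epsilon_Y$ is a reduction, provided that $Y$ is nonempty or $X$ is empty, and $\gamma_f\times 1_Y$ is a coreduction, provided that $f$ is nonempty or $Y$ is empty. (Both provisos hold whenever $f\neq\emptyset$.) -/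

import Mathlib

open scoped Manifold ContDiff

noncomputable section

namespace CanRel

section Relations

variable {X Y X' Y' : Type*}

/-! A relation `f : X ← Y` (target `X`, source `Y`) is a subset of `X × Y`, that is, a `SetRel X Y`.
With this convention `SetRel.comp f g` is `f ∘ g = {(x, z) | ∃ y, (x, y) ∈ f ∧ (y, z) ∈ g}`,
`SetRel.id` is `1_X`, and `SetRel.inv` is transposition. -/

/-- The range of `f` is the whole target. -/
def RelSurjective (f : SetRel X Y) : Prop := ∀ x, ∃ y, (x, y) ∈ f

/-- `f` is single valued: for every `y` in the source there is at most one `(x, y) ∈ f`. -/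
def RelCoinjective (f : SetRel X Y) : Prop := ∀ ⦃y x x'⦄, (x, y) ∈ f → (x', y) ∈ f → x = x'

/-- The product `f × f' : X × X' ← Y × Y'` of two relations. -/
def relProd (f : SetRel X Y) (f' : SetRel X' Y') : SetRel (X × X') (Y × Y') :=
  {p | (p.1.1, p.2.1) ∈ f ∧ (p.1.2, p.2.2) ∈ f'}

/-- `ε_Y : 1 ← Y × Y`, the diagonal of `Y` seen as a relation to a point. -/
def epsilonRel (Y : Type*) : SetRel Unit (Y × Y) := {p | p.2.1 = p.2.2}

/-- `γ_f : X × Y ← 1`, the graph of `f` (the set `f` itself) seen as a relation from a point. -/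
def graphRel (f : SetRel X Y) : SetRel (X × Y) Unit := {p | p.1 ∈ f}

/-- `1_X × ε_Y : X = X × 1 ← X × Y × Y`. -/
def idProdEpsilon (X Y : Type*) : SetRel X (X × Y × Y) :=
  {p | ((p.1, ()), p.2) ∈ relProd (SetRel.id : SetRel X X) (epsilonRel Y)}

/-- `γ_f × 1_Y : X × Y × Y = (X × Y) × Y ← 1 × Y = Y`. -/
def graphProdId (f : SetRel X Y) : SetRel (X × Y × Y) Y :=
  {p | (((p.1.1, p.1.2.1), p.1.2.2), ((), p.2)) ∈ relProd (graphRel f) (SetRel.id : SetRel Y Y)}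

end Relations

section Manifolds

variable {E H M : Type*} [NormedAddCommGroup E] [NormedSpace ℝ E] [TopologicalSpace H]
  (I : ModelWithCorners ℝ E H) [TopologicalSpace M] [ChartedSpace H M]
variable {E' H' M' : Type*} [NormedAddCommGroup E'] [NormedSpace ℝ E'] [TopologicalSpace H']
  (I' : ModelWithCorners ℝ E' H') [TopologicalSpace M'] [ChartedSpace H' M']
variable {E'' H'' M'' : Type*} [NormedAddCommGroup E''] [NormedSpace ℝ E''] [TopologicalSpace H'']
  (I'' : ModelWithCorners ℝ E'' H'') [TopologicalSpace M''] [ChartedSpace H'' M'']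

/-- A closed (embedded) submanifold of a manifold without boundary: a closed subset which near each
of its points `p` is the zero set of a smooth map to some `ℝᵏ` that is a submersion at `p`. -/
def IsClosedSubmanifold (S : Set M) : Prop :=
  IsClosed S ∧ ∀ p ∈ S, ∃ U : Set M, IsOpen U ∧ p ∈ U ∧
    ∃ (k : ℕ) (g : M → EuclideanSpace ℝ (Fin k)),
      ContMDiffOn I 𝓘(ℝ, EuclideanSpace ℝ (Fin k)) ∞ g U ∧
      Function.Surjective (mfderiv I 𝓘(ℝ, EuclideanSpace ℝ (Fin k)) g p) ∧
      S ∩ U = {q ∈ U | g q = 0}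

/-- The tangent bundle `TS ⊆ TM` of a submanifold `S` of `M`: the set of velocities at time `0` of
smooth curves in `M` that stay in `S` for small times. -/
def tangentSet (S : Set M) : Set (TangentBundle I M) :=
  {v | ∃ γ : ℝ → M, ContMDiffAt 𝓘(ℝ, ℝ) I ∞ γ 0 ∧ (∀ᶠ t in nhds (0 : ℝ), γ t ∈ S) ∧
    tangentMap 𝓘(ℝ, ℝ) I γ ⟨0, (1 : ℝ)⟩ = v}

/-- The tangent space `T_p S ⊆ T_p M` of a submanifold `S` of `M`. -/
def tangentSetAt (S : Set M) (p : M) : Set (TangentSpace I p) :=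
  {v | (⟨p, v⟩ : TangentBundle I M) ∈ tangentSet I S}

/-- `A` and `B` are transversal in `M`: `T_p A + T_p B = T_p M` for all `p ∈ A ∩ B`. -/
def IsTransversal (A B : Set M) : Prop :=
  ∀ p ∈ A ∩ B, ∀ v : TangentSpace I p,
    ∃ a ∈ tangentSetAt I A p, ∃ b ∈ tangentSetAt I B p, a + b = v

/-- The restriction to the submanifold `N ⊆ M` of the smooth map `π : M → M'` is an embedding
(a topological embedding with injective differentials) onto a closed submanifold of `M'`. -/
structure IsEmbeddingOntoClosedSubmanifold (N : Set M) (π : M → M') : Prop where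
  isEmbedding : Topology.IsEmbedding (fun p : N => π p)
  immersion : ∀ p ∈ N, Set.InjOn (mfderiv I I' π p) (tangentSetAt I N p)
  image : IsClosedSubmanifold I' (π '' N)

/-- The differential `Tf : TM ← TM'` of a smooth relation `f : M ← M'`, that is, the tangent bundle
of `f` under the identification of `T(M × M')` with `TM × TM'`. -/
def tangentRel (f : SetRel M M') : SetRel (TangentBundle I M) (TangentBundle I' M') :=
  {q | (equivTangentBundleProd I M I' M').symm q ∈ tangentSet (I.prod I') f}

/-- A smooth relation: a closed submanifold of the product. -/
def IsSmoothRel (f : SetRel M M') : Prop := IsClosedSubmanifold (I.prod I') f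

/-- A reduction `f : M ← M'`: a smooth relation which is surjective and coinjective, along with its
differential, and whose projection to the source `M'` is proper. (Coinjectivity of `f` says that
this projection is injective.) -/
structure IsReduction (f : SetRel M M') : Prop where
  smooth : IsSmoothRel I I' f
  surjective : RelSurjective f
  coinjective : RelCoinjective f
  tangent_surjective : RelSurjective (tangentRel I I' f)
  tangent_coinjective : RelCoinjective (tangentRel I I' f)
  proper : IsProperMap (fun p : f => p.1.2)

/-- A coreduction: the transpose is a reduction. -/
def IsCoreduction (f : SetRel M M') : Prop := IsReduction I' I f.inv

/-- `M × Δ_{M'} × M''` inside `(M × M') × (M' × M'')`. -/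
def middleDiagonal (M M' M'' : Type*) : Set ((M × M') × (M' × M'')) := {p | p.1.2 = p.2.1}

/-- The fibre product `f ×_{M'} g`, a subset of `(M × M') × (M' × M'')`. -/
def fibreProduct (f : SetRel M M') (g : SetRel M' M'') : Set ((M × M') × (M' × M'')) :=
  (f ×ˢ g) ∩ middleDiagonal M M' M''

/-- The pair `(f, g)` of smooth relations is transversal: `f × g` is transversal to
`M × Δ_{M'} × M''`. -/
def IsTransversalPair (f : SetRel M M') (g : SetRel M' M'') : Prop :=
  IsTransversal ((I.prod I').prod (I'.prod I'')) (f ×ˢ g) (middleDiagonal M M' M'')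

/-- The pair `(f, g)` of smooth relations is strongly transversal: it is transversal and the
projection of `f ×_{M'} g` to `M × M''` is an embedding onto a closed submanifold. -/
structure IsStronglyTransversal (f : SetRel M M') (g : SetRel M' M'') : Prop where
  transversal : IsTransversalPair I I' I'' f g
  embedding : IsEmbeddingOntoClosedSubmanifold ((I.prod I').prod (I'.prod I'')) (I.prod I'')
    (fibreProduct f g) (fun p => (p.1.1, p.2.2))

end Manifolds

section Symplectic

variable {E H : Type*} [NormedAddCommGroup E] [NormedSpace ℝ E] [TopologicalSpace H]
  (I : ModelWithCorners ℝ E H) {M : Type*} [TopologicalSpace M] [ChartedSpace H M]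
variable {E' H' : Type*} [NormedAddCommGroup E'] [NormedSpace ℝ E'] [TopologicalSpace H']
  (I' : ModelWithCorners ℝ E' H') {M' : Type*} [TopologicalSpace M'] [ChartedSpace H' M']

/-- A (not necessarily smooth) differential 2-form on `M`. -/
abbrev TwoForm (M : Type*) [TopologicalSpace M] [ChartedSpace H M] : Type _ :=
  ∀ p : M, TangentSpace I p [⋀^Fin 2]→L[ℝ] ℝ

variable {I I'} in
/-- The pullback `φ^* σ`. -/
def TwoForm.pullback (φ : M → M') (σ : TwoForm I' M') : TwoForm I M :=
  fun p => (σ (φ p)).compContinuousLinearMap (mfderiv I I' φ p)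

variable {I} in
/-- The form `-σ` of the dual symplectic manifold. -/
def TwoForm.dual (σ : TwoForm I M) : TwoForm I M := fun p => -σ p

variable {I I'} in
/-- The form `pr₁^* σ + pr₂^* σ'` on the product `M × M'`. -/
def TwoForm.prod (σ : TwoForm I M) (σ' : TwoForm I' M') : TwoForm (I.prod I') (M × M') :=
  fun p => TwoForm.pullback Prod.fst σ p + TwoForm.pullback Prod.snd σ' p

variable {I} in
/-- The expression of `σ` in the preferred chart at `x₀`, a 2-form on the model space `E`
(meaningful on the target of the chart). -/
def TwoForm.inChart (σ : TwoForm I M) (x₀ : M) : E → E [⋀^Fin 2]→L[ℝ] ℝ :=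
  TwoForm.pullback (I := 𝓘(ℝ, E)) (I' := I) (extChartAt I x₀).symm σ

/-- `σ` is a symplectic form on the manifold `M` without boundary: it is smooth, closed and
nondegenerate. -/
structure IsSymplectic (σ : TwoForm I M) : Prop where
  smooth : ∀ x₀ : M, ContDiffOn ℝ ∞ (σ.inChart x₀) (extChartAt I x₀).target
  closed : ∀ x₀ : M, ∀ u ∈ (extChartAt I x₀).target, extDeriv (σ.inChart x₀) u = 0
  nondegenerate : ∀ (p : M) (v : TangentSpace I p), (∀ w : TangentSpace I p, σ p ![v, w] = 0) → v = 0

/-- A submanifold `L` is lagrangian: each `T_p L` equals its own `σ`-orthogonal in `T_p M`. -/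
def IsLagrangian (σ : TwoForm I M) (L : Set M) : Prop :=
  ∀ p ∈ L, tangentSetAt I L p =
    {v : TangentSpace I p | ∀ w ∈ tangentSetAt I L p, σ p ![v, w] = 0}

/-- A canonical relation `f : (M, σ) ← (M', σ')`: a smooth relation which is lagrangian as a
submanifold of `(M, σ) × (M', -σ')`. -/
structure IsCanonicalRel (σ : TwoForm I M) (σ' : TwoForm I' M') (f : SetRel M M') : Prop where
  smooth : IsSmoothRel I I' f
  lagrangian : IsLagrangian (I.prod I') (σ.prod σ'.dual) f

end Symplectic

end CanRel

end

namespace CanRel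

section Velocity

variable {E H M : Type*} [NormedAddCommGroup E] [NormedSpace ℝ E] [TopologicalSpace H]
  {I : ModelWithCorners ℝ E H} [TopologicalSpace M] [ChartedSpace H M]
variable {E' H' M' : Type*} [NormedAddCommGroup E'] [NormedSpace ℝ E'] [TopologicalSpace H']
  {I' : ModelWithCorners ℝ E' H'} [TopologicalSpace M'] [ChartedSpace H' M']

variable (I) in
/-- The curve `γ` is smooth at time `0`, where it passes through `p` with velocity `v`. -/
structure HasVelocity (γ : ℝ → M) (p : M) (v : E) : Prop where
  smooth : ContMDiffAt 𝓘(ℝ, ℝ) I ∞ γ 0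
  base : γ 0 = p
  velocity : (mfderiv 𝓘(ℝ, ℝ) I γ 0 : ℝ →L[ℝ] E) 1 = v

theorem mem_tangentSetAt_iff {S : Set M} {p : M} {v : TangentSpace I p} :
    v ∈ tangentSetAt I S p ↔
      ∃ γ : ℝ → M, HasVelocity I γ p v ∧ ∀ᶠ t in nhds (0 : ℝ), γ t ∈ S := by
  constructor
  · rintro ⟨γ, hγ, hS, h⟩
    have h1 : γ 0 = p := congrArg Bundle.TotalSpace.proj h
    subst h1
    refine ⟨γ, ⟨hγ, rfl, ?_⟩, hS⟩
    have := Bundle.TotalSpace.mk_injective _ h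
    exact this
  · rintro ⟨γ, ⟨hγ, rfl, h⟩, hS⟩
    exact ⟨γ, hγ, hS, congrArg (Bundle.TotalSpace.mk (γ 0)) h⟩

theorem HasVelocity.mdifferentiableAt {γ : ℝ → M} {p : M} {v : E} (h : HasVelocity I γ p v) :
    MDifferentiableAt 𝓘(ℝ, ℝ) I γ 0 :=
  h.smooth.mdifferentiableAt (by simp)

theorem hasVelocity_const (p : M) : HasVelocity I (fun _ => p) p 0 :=
  ⟨contMDiffAt_const, rfl, by rw [mfderiv_const]; rfl⟩

theorem HasVelocity.comp {γ : ℝ → M} {p : M} {v : TangentSpace I p} (h : HasVelocity I γ p v)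
    {φ : M → M'} (hφ : ContMDiffAt I I' ∞ φ p) :
    HasVelocity I' (fun t => φ (γ t)) (φ p) (mfderiv I I' φ p v) := by
  obtain ⟨hγ, rfl, rfl⟩ := h
  refine ⟨hφ.comp _ hγ, rfl, ?_⟩
  have := mfderiv_comp (I := 𝓘(ℝ, ℝ)) (I' := I) (I'' := I') (0 : ℝ)
    (hφ.mdifferentiableAt (by simp)) (hγ.mdifferentiableAt (by simp))
  exact congrArg (fun L : ℝ →L[ℝ] E' => L 1) this

theorem HasVelocity.prodMk {γ : ℝ → M} {p : M} {v : E} (h : HasVelocity I γ p v)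
    {γ' : ℝ → M'} {p' : M'} {v' : E'} (h' : HasVelocity I' γ' p' v') :
    HasVelocity (I.prod I') (fun t => (γ t, γ' t)) (p, p') (v, v') := by
  refine ⟨h.smooth.prodMk h'.smooth, Prod.ext h.base h'.base, ?_⟩
  have := h.mdifferentiableAt.mfderiv_prod h'.mdifferentiableAt
  refine (congrArg (fun L : ℝ →L[ℝ] E × E' => L 1) this).trans ?_
  exact Prod.ext h.velocity h'.velocity

theorem HasVelocity.fst {γ : ℝ → M × M'} {p : M × M'} {v : E × E'}
    (h : HasVelocity (I.prod I') γ p v) : HasVelocity I (fun t => (γ t).1) p.1 v.1 := by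
  have := HasVelocity.comp (I := I.prod I') (I' := I) (v := v) h (φ := Prod.fst) contMDiffAt_fst
  rwa [mfderiv_fst] at this

theorem HasVelocity.snd {γ : ℝ → M × M'} {p : M × M'} {v : E × E'}
    (h : HasVelocity (I.prod I') γ p v) : HasVelocity I' (fun t => (γ t).2) p.2 v.2 := by
  have := HasVelocity.comp (I := I.prod I') (I' := I') (v := v) h (φ := Prod.snd) contMDiffAt_snd
  rwa [mfderiv_snd] at this

theorem HasVelocity.unique {γ γ' : ℝ → M} {p p' : M} {v v' : E} (h : HasVelocity I γ p v)
    (h' : HasVelocity I γ' p' v') (hγ : γ =ᶠ[nhds 0] γ') : v = v' := by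
  have h0 : γ 0 = γ' 0 := hγ.self_of_nhds
  have := hγ.mfderiv_eq (I := 𝓘(ℝ, ℝ)) (I' := I)
  rw [← h.velocity, ← h'.velocity]
  exact congrArg (fun L : ℝ →L[ℝ] E => L 1) this

theorem HasVelocity.hasDerivAt {c : ℝ → E} {p v : E} (h : HasVelocity 𝓘(ℝ, E) c p v) :
    HasDerivAt c v 0 := by
  have h1 := h.velocity
  have : mfderiv 𝓘(ℝ, ℝ) 𝓘(ℝ, E) c 0 = fderiv ℝ c 0 := mfderiv_eq_fderiv
  have h2 := (congrArg (fun L : ℝ →L[ℝ] E => L 1) this).symm.trans h1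
  have h3 := (h.smooth.contDiffAt.differentiableAt (by simp)).hasDerivAt
  rw [← h2]; exact h3

theorem exists_hasVelocity [I.Boundaryless] [IsManifold I ∞ M] (p : M) (v : E) :
    ∃ γ : ℝ → M, HasVelocity I γ p v ∧
      ∀ᶠ t in nhds (0 : ℝ), extChartAt I p (γ t) = extChartAt I p p + t • v := by
  set c : ℝ → E := fun t => extChartAt I p p + t • v with hc
  have hcs : ContDiff ℝ ∞ c := by fun_prop
  have hc0 : c 0 = extChartAt I p p := by simp [hc]
  have hcv : HasDerivAt c v 0 := by
    simpa [hc] using ((hasDerivAt_id (0 : ℝ)).smul_const v).const_add (extChartAt I p p)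
  have hev : ∀ᶠ t in nhds (0 : ℝ), c t ∈ (extChartAt I p).target :=
    hcs.continuous.continuousAt.eventually_mem (by
      rw [hc0]; exact extChartAt_target_mem_nhds p)
  have hs : ContMDiffAt 𝓘(ℝ, E) I ∞ (extChartAt I p).symm (c 0) := by
    rw [hc0]
    exact (contMDiffOn_extChartAt_symm p).contMDiffAt (extChartAt_target_mem_nhds p)
  set γ : ℝ → M := fun t => (extChartAt I p).symm (c t) with hγ
  have hγs : ContMDiffAt 𝓘(ℝ, ℝ) I ∞ γ 0 := hs.comp _ hcs.contDiffAt.contMDiffAt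
  have hγ0 : γ 0 = p := by simp only [hγ, hc0, extChartAt_to_inv]
  have hright : ∀ᶠ t in nhds (0 : ℝ), extChartAt I p (γ t) = c t :=
    hev.mono fun t ht => (extChartAt I p).right_inv ht
  refine ⟨γ, ⟨hγs, hγ0, ?_⟩, hright⟩
  have h1 : HasFDerivAt (fun t => extChartAt I (γ 0) (γ t))
      (ContinuousLinearMap.toSpanSingleton ℝ v) 0 := by
    rw [hγ0]
    exact hcv.hasFDerivAt.congr_of_eventuallyEq hright
  have h2 : HasMFDerivAt 𝓘(ℝ, ℝ) I γ 0 (ContinuousLinearMap.toSpanSingleton ℝ v : ℝ →L[ℝ] E) :=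
    ⟨hγs.continuousAt, h1.hasFDerivWithinAt⟩
  refine (congrArg (fun L : ℝ →L[ℝ] E => L 1) h2.mfderiv).trans ?_
  exact one_smul ℝ v

end Velocity
end CanRel

namespace CanRel

section Submanifold

variable {E H M : Type*} [NormedAddCommGroup E] [NormedSpace ℝ E] [TopologicalSpace H]
  {I : ModelWithCorners ℝ E H} [TopologicalSpace M] [ChartedSpace H M]
variable {E' H' N : Type*} [NormedAddCommGroup E'] [NormedSpace ℝ E'] [TopologicalSpace H']
  {I' : ModelWithCorners ℝ E' H'} [TopologicalSpace N] [ChartedSpace H' N]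
variable {F K Y : Type*} [NormedAddCommGroup F] [NormedSpace ℝ F] [FiniteDimensional ℝ F]
  [TopologicalSpace K]
  {J : ModelWithCorners ℝ F K} [TopologicalSpace Y] [ChartedSpace K Y]

/-- A submanifold may be cut out by maps to finite-dimensional normed spaces instead of `ℝᵏ`, and
submersivity may be tested on curves. -/
theorem exists_euclidean_submersion {S : Set M} {p : M} {U : Set M} (hU : IsOpen U) (hpU : p ∈ U)
    {g : M → F} (hg : ContMDiffOn I 𝓘(ℝ, F) ∞ g U)
    (hsurj : ∀ w : F, ∃ γ v, HasVelocity I γ p v ∧ HasDerivAt (fun t => g (γ t)) w 0)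
    (hSU : S ∩ U = {q ∈ U | g q = 0}) :
    ∃ U : Set M, IsOpen U ∧ p ∈ U ∧ ∃ (k : ℕ) (g : M → EuclideanSpace ℝ (Fin k)),
      ContMDiffOn I 𝓘(ℝ, EuclideanSpace ℝ (Fin k)) ∞ g U ∧
      Function.Surjective (mfderiv I 𝓘(ℝ, EuclideanSpace ℝ (Fin k)) g p) ∧
      S ∩ U = {q ∈ U | g q = 0} := by
  have hgp : ContMDiffAt I 𝓘(ℝ, F) ∞ g p := hg.contMDiffAt (hU.mem_nhds hpU)
  set e : F ≃L[ℝ] EuclideanSpace ℝ (Fin (Module.finrank ℝ F)) := toEuclidean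
  have he : ContMDiff 𝓘(ℝ, F) 𝓘(ℝ, EuclideanSpace ℝ (Fin (Module.finrank ℝ F))) ∞ e :=
    e.contDiff.contMDiff
  refine ⟨U, hU, hpU, Module.finrank ℝ F, fun q => e (g q), he.comp_contMDiffOn hg, fun w => ?_, ?_⟩
  · obtain ⟨γ, v, hγ, hw⟩ := hsurj (e.symm w)
    have h1 := (HasVelocity.comp hγ (he.contMDiffAt.comp p hgp)).hasDerivAt
    have h2 := (e.toContinuousLinearMap).hasFDerivAt.comp_hasDerivAt (0 : ℝ) hw
    exact ⟨v, (h1.unique h2).trans (e.apply_symm_apply w)⟩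
  · rw [hSU]
    ext q
    simp

theorem isClosedSubmanifold_univ : IsClosedSubmanifold I (Set.univ : Set M) := by
  refine ⟨isClosed_univ, fun p _ => exists_euclidean_submersion (F := Fin 0 → ℝ) isOpen_univ
    (Set.mem_univ p) (g := fun _ => 0) contMDiffOn_const (fun w => ?_) ?_⟩
  · refine ⟨fun _ => p, 0, hasVelocity_const p, ?_⟩
    rw [Subsingleton.elim w 0]
    exact hasDerivAt_const _ _
  · ext; simp

/-- The part of the preimage of a closed submanifold `S` under a map `π` on which two maps `α`, `β`
agree is a closed submanifold, if there are enough curves. -/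
theorem IsClosedSubmanifold.preimage_inter_eq [T2Space Y] [IsManifold J ∞ Y]
    {S : Set M} (hS : IsClosedSubmanifold I S) {π : N → M} {α β : N → Y}
    (hπ : ContMDiff I' I ∞ π) (hα : ContMDiff I' J ∞ α) (hβ : ContMDiff I' J ∞ β)
    (h : ∀ p, π p ∈ S → α p = β p → ∀ (v : E) (w : F), ∃ γ u, HasVelocity I' γ p u ∧
      HasVelocity I (fun t => π (γ t)) (π p) v ∧
      HasDerivAt (fun t => extChartAt J (α p) (α (γ t))) w 0 ∧ ∀ t, β (γ t) = β p) :
    IsClosedSubmanifold I' {n | π n ∈ S ∧ α n = β n} := by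
  refine ⟨(hS.1.preimage hπ.continuous).inter (isClosed_eq hα.continuous hβ.continuous), ?_⟩
  rintro p ⟨hpS, hp⟩
  obtain ⟨U, hU, hpU, k, g, hg, hsurj, hSU⟩ := hS.2 _ hpS
  set V : Set N := π ⁻¹' U ∩ (α ⁻¹' (extChartAt J (α p)).source ∩
    β ⁻¹' (extChartAt J (α p)).source)
  refine exists_euclidean_submersion (U := V)
    (g := fun n => (g (π n), extChartAt J (α p) (α n) - extChartAt J (α p) (β n))) ?_ ?_ ?_ ?_ ?_
  · exact (hU.preimage hπ.continuous).inter
      (((isOpen_extChartAt_source _).preimage hα.continuous).inter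
        ((isOpen_extChartAt_source _).preimage hβ.continuous))
  · refine ⟨hpU, mem_extChartAt_source _, ?_⟩
    show β p ∈ (extChartAt J (α p)).source
    rw [← hp]; exact mem_extChartAt_source _
  · have hc : ContMDiffOn J 𝓘(ℝ, F) ∞ (extChartAt J (α p)) (extChartAt J (α p)).source := by
      rw [extChartAt_source]; exact contMDiffOn_extChartAt
    refine (hg.comp hπ.contMDiffOn fun n hn => hn.1).prodMk_space ?_
    exact (hc.comp hα.contMDiffOn fun n hn => hn.2.1).sub
      (hc.comp hβ.contMDiffOn fun n hn => hn.2.2)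
  · rintro ⟨w₁, w₂⟩
    obtain ⟨v, hv⟩ := hsurj w₁
    obtain ⟨γ, u, hγ, hγπ, hγα, hγβ⟩ := h p hpS hp v w₂
    refine ⟨γ, u, hγ, ?_⟩
    have h1 := (HasVelocity.comp hγπ (hg.contMDiffAt (hU.mem_nhds hpU))).hasDerivAt
    have h1' : HasDerivAt (fun t => g (π (γ t))) w₁ 0 := by rw [← hv]; exact h1
    refine h1'.prodMk ?_
    simp only [hγβ]
    exact hγα.sub_const _
  · ext n
    constructor
    · rintro ⟨⟨hn, hn'⟩, hnV⟩
      refine ⟨hnV, Prod.ext ?_ ?_⟩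
      · exact ((Set.ext_iff.1 hSU (π n)).1 ⟨hn, hnV.1⟩).2
      · simp [hn']
    · rintro ⟨hnV, hn⟩
      refine ⟨⟨?_, ?_⟩, hnV⟩
      · exact ((Set.ext_iff.1 hSU (π n)).2 ⟨hnV.1, (Prod.ext_iff.1 hn).1⟩).1
      · exact (extChartAt J (α p)).injOn hnV.2.1 hnV.2.2 (sub_eq_zero.1 (Prod.ext_iff.1 hn).2)

end Submanifold

section Forms

variable {E H : Type*} [NormedAddCommGroup E] [NormedSpace ℝ E] [TopologicalSpace H]
  {I : ModelWithCorners ℝ E H} {M : Type*} [TopologicalSpace M] [ChartedSpace H M]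
variable {E' H' : Type*} [NormedAddCommGroup E'] [NormedSpace ℝ E'] [TopologicalSpace H']
  {I' : ModelWithCorners ℝ E' H'} {M' : Type*} [TopologicalSpace M'] [ChartedSpace H' M']

/-- The number `σ_p(v, w)`. -/
noncomputable def TwoForm.pairing (σ : TwoForm I M) (p : M) (v w : E) : ℝ :=
  (σ p : E [⋀^Fin 2]→L[ℝ] ℝ) ![v, w]

theorem TwoForm.pairing_dual (σ : TwoForm I M) (p : M) (v w : E) :
    σ.dual.pairing p v w = -σ.pairing p v w := rfl

theorem TwoForm.prod_apply (σ : TwoForm I M) (σ' : TwoForm I' M') (p : M × M')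
    (m : Fin 2 → E × E') :
    (σ.prod σ' p : (E × E') [⋀^Fin 2]→L[ℝ] ℝ) m =
      (σ p.1 : E [⋀^Fin 2]→L[ℝ] ℝ) (fun i => (m i).1) +
        (σ' p.2 : E' [⋀^Fin 2]→L[ℝ] ℝ) (fun i => (m i).2) := by
  have h : TwoForm.prod σ σ' p =
      (σ p.1).compContinuousLinearMap (mfderiv (I.prod I') I Prod.fst p) +
      (σ' p.2).compContinuousLinearMap (mfderiv (I.prod I') I' Prod.snd p) := rfl
  rw [mfderiv_fst, mfderiv_snd] at h
  rw [h]
  rfl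

theorem TwoForm.pairing_prod (σ : TwoForm I M) (σ' : TwoForm I' M') (p : M × M')
    (v w : E × E') :
    (σ.prod σ').pairing p v w = σ.pairing p.1 v.1 w.1 + σ'.pairing p.2 v.2 w.2 := by
  refine (TwoForm.prod_apply σ σ' p ![v, w]).trans ?_
  refine congrArg₂ (· + ·) (congrArg (σ p.1) ?_) (congrArg (σ' p.2) ?_) <;>
  · ext i; fin_cases i <;> rfl

theorem TwoForm.pairing_zero_right (σ : TwoForm I M) (p : M) (v : E) : σ.pairing p v 0 = 0 :=
  (σ p).map_coord_zero 1 rfl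

theorem TwoForm.pairing_sub_left (σ : TwoForm I M) (p : M) (v v' w : E) :
    σ.pairing p (v - v') w = σ.pairing p v w - σ.pairing p v' w := by
  have h (τ : E [⋀^Fin 2]→L[ℝ] ℝ) : τ ![v - v', w] = τ ![v, w] - τ ![v', w] := by
    simp
  exact h (σ p)

theorem IsSymplectic.eq_zero {σ : TwoForm I M} (h : IsSymplectic I σ) (p : M) (v : E)
    (hv : ∀ w : E, σ.pairing p v w = 0) : v = 0 :=
  h.nondegenerate p v hv

theorem isLagrangian_iff {σ : TwoForm I M} {L : Set M} :
    IsLagrangian I σ L ↔ ∀ p ∈ L, ∀ v : E, v ∈ tangentSetAt I L p ↔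
      ∀ w : E, w ∈ tangentSetAt I L p → σ.pairing p v w = 0 :=
  forall₂_congr fun _ _ => Set.ext_iff

theorem IsSymplectic.dual {σ : TwoForm I M} (h : IsSymplectic I σ) : IsSymplectic I σ.dual := by
  have hc : ∀ x₀, σ.dual.inChart x₀ = fun u => -σ.inChart x₀ u := fun x₀ => rfl
  refine ⟨fun x₀ => ?_, fun x₀ u hu => ?_, fun p v hv => h.nondegenerate p v fun w => ?_⟩
  · rw [hc]; exact (h.smooth x₀).neg
  · have : σ.dual.inChart x₀ = (-1 : ℝ) • σ.inChart x₀ := by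
      rw [hc]; ext1 u; exact (neg_one_smul ℝ _).symm
    rw [this, extDeriv_smul, h.closed x₀ u hu, smul_zero]
  · exact neg_eq_zero.1 (hv w)

theorem TwoForm.inChart_prod [I.Boundaryless] [I'.Boundaryless] [IsManifold I ∞ M]
    [IsManifold I' ∞ M'] (σ : TwoForm I M) (σ' : TwoForm I' M') (x : M) (x' : M')
    {u : E × E'} (hu : u.1 ∈ (extChartAt I x).target) (hu' : u.2 ∈ (extChartAt I' x').target) :
    (σ.prod σ').inChart (x, x') u =
      (σ.inChart x u.1).compContinuousLinearMap (ContinuousLinearMap.fst ℝ E E') +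
      (σ'.inChart x' u.2).compContinuousLinearMap (ContinuousLinearMap.snd ℝ E E') := by
  have h₁ : MDifferentiableAt 𝓘(ℝ, E) I (extChartAt I x).symm u.1 :=
    ((contMDiffOn_extChartAt_symm (n := ∞) x).contMDiffAt
      ((isOpen_extChartAt_target x).mem_nhds hu)).mdifferentiableAt (by simp)
  have h₂ : MDifferentiableAt 𝓘(ℝ, E') I' (extChartAt I' x').symm u.2 :=
    ((contMDiffOn_extChartAt_symm (n := ∞) x').contMDiffAt
      ((isOpen_extChartAt_target x').mem_nhds hu')).mdifferentiableAt (by simp)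
  have hf : HasMFDerivAt 𝓘(ℝ, E × E') 𝓘(ℝ, E) Prod.fst u (ContinuousLinearMap.fst ℝ E E') :=
    hasFDerivAt_fst.hasMFDerivAt
  have hs : HasMFDerivAt 𝓘(ℝ, E × E') 𝓘(ℝ, E') Prod.snd u (ContinuousLinearMap.snd ℝ E E') :=
    hasFDerivAt_snd.hasMFDerivAt
  have hd : HasMFDerivAt 𝓘(ℝ, E × E') (I.prod I') (extChartAt (I.prod I') (x, x')).symm u _ :=
    (h₁.hasMFDerivAt.comp u hf).prodMk (h₂.hasMFDerivAt.comp u hs)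
  ext m
  refine (TwoForm.prod_apply σ σ' ((extChartAt (I.prod I') (x, x')).symm u) fun i =>
    mfderiv 𝓘(ℝ, E × E') (I.prod I') (extChartAt (I.prod I') (x, x')).symm u (m i)).trans ?_
  refine congrArg₂ (· + ·)
    (congrArg (σ ((extChartAt I x).symm u.1) : E [⋀^Fin 2]→L[ℝ] ℝ) (funext fun i => ?_))
    (congrArg (σ' ((extChartAt I' x').symm u.2) : E' [⋀^Fin 2]→L[ℝ] ℝ) (funext fun i => ?_))
  · exact congrArg (fun L : E × E' →L[ℝ] E × E' => (L (m i)).1) hd.mfderiv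
  · exact congrArg (fun L : E × E' →L[ℝ] E × E' => (L (m i)).2) hd.mfderiv

theorem IsSymplectic.prod [I.Boundaryless] [I'.Boundaryless] [IsManifold I ∞ M]
    [IsManifold I' ∞ M'] {σ : TwoForm I M} {σ' : TwoForm I' M'}
    (h : IsSymplectic I σ) (h' : IsSymplectic I' σ') :
    IsSymplectic (I.prod I') (σ.prod σ') := by
  have hm : ∀ (x : M) (x' : M'), ∀ u ∈ (extChartAt (I.prod I') (x, x')).target,
      u.1 ∈ (extChartAt I x).target ∧ u.2 ∈ (extChartAt I' x').target := by
    intro x x' u hu; rwa [extChartAt_prod] at hu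
  refine ⟨?_, ?_, ?_⟩
  · rintro ⟨x, x'⟩
    refine ContDiffOn.congr ?_ fun u hu =>
      TwoForm.inChart_prod σ σ' x x' (hm x x' u hu).1 (hm x x' u hu).2
    refine ContDiffOn.add ?_ ?_
    · exact (ContinuousAlternatingMap.compContinuousLinearMapCLM (F := ℝ) (ι := Fin 2)
        (ContinuousLinearMap.fst ℝ E E')).contDiff.comp_contDiffOn
        ((h.smooth x).comp contDiff_fst.contDiffOn fun u hu => (hm x x' u hu).1)
    · exact (ContinuousAlternatingMap.compContinuousLinearMapCLM (F := ℝ) (ι := Fin 2)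
        (ContinuousLinearMap.snd ℝ E E')).contDiff.comp_contDiffOn
        ((h'.smooth x').comp contDiff_snd.contDiffOn fun u hu => (hm x x' u hu).2)
  · rintro ⟨x, x'⟩ u hu
    obtain ⟨hu₁, hu₂⟩ := hm x x' u hu
    have hd₁ : DifferentiableAt ℝ (σ.inChart x) u.1 :=
      ((h.smooth x).contDiffAt ((isOpen_extChartAt_target x).mem_nhds hu₁)).differentiableAt
        (by simp)
    have hd₂ : DifferentiableAt ℝ (σ'.inChart x') u.2 :=
      ((h'.smooth x').contDiffAt ((isOpen_extChartAt_target x').mem_nhds hu₂)).differentiableAt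
        (by simp)
    have hev : (σ.prod σ').inChart (x, x') =ᶠ[nhds u] fun u =>
        (σ.inChart x u.1).compContinuousLinearMap (fderiv ℝ Prod.fst u) +
        (σ'.inChart x' u.2).compContinuousLinearMap (fderiv ℝ Prod.snd u) := by
      filter_upwards [(isOpen_extChartAt_target (I := I.prod I') (x, x')).mem_nhds hu] with q hq
      rw [TwoForm.inChart_prod σ σ' x x' (hm x x' q hq).1 (hm x x' q hq).2, fderiv_fst, fderiv_snd]
    rw [hev.extDeriv_eq, extDeriv_fun_add, extDeriv_pullback hd₁ (r := ⊤) contDiffAt_fst le_top,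
      extDeriv_pullback hd₂ (r := ⊤) contDiffAt_snd le_top, h.closed x _ hu₁,
      h'.closed x' _ hu₂]
    · ext m; exact add_zero (0 : ℝ)
    · simp only [fderiv_fst]
      exact (ContinuousAlternatingMap.compContinuousLinearMapCLM (F := ℝ) (ι := Fin 2)
        (ContinuousLinearMap.fst ℝ E E')).differentiableAt.comp u
          (hd₁.comp u differentiableAt_fst)
    · simp only [fderiv_snd]
      exact (ContinuousAlternatingMap.compContinuousLinearMapCLM (F := ℝ) (ι := Fin 2)
        (ContinuousLinearMap.snd ℝ E E')).differentiableAt.comp u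
          (hd₂.comp u differentiableAt_snd)
  · rintro p v hv
    refine Prod.ext (h.eq_zero p.1 _ fun w => ?_) (h'.eq_zero p.2 _ fun w => ?_)
    · have := (TwoForm.pairing_prod σ σ' p v (w, 0)).symm.trans (hv (w, 0))
      rwa [TwoForm.pairing_zero_right, add_zero] at this
    · have := (TwoForm.pairing_prod σ σ' p v (0, w)).symm.trans (hv (0, w))
      rwa [TwoForm.pairing_zero_right, zero_add] at this

end Forms
end CanRel

namespace CanRel

section Relations

variable {X Y : Type*}

theorem mem_idProdEpsilon {p : X × X × Y × Y} :
    p ∈ idProdEpsilon X Y ↔ p.1 = p.2.1 ∧ p.2.2.1 = p.2.2.2 := Iff.rfl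

theorem comp_idProdEpsilon_graphProdId (f : SetRel X Y) :
    SetRel.comp (idProdEpsilon X Y) (graphProdId f) = f := by
  ext ⟨x, y⟩
  constructor
  · rintro ⟨⟨x', y', y''⟩, ⟨h₁, h₂⟩, h₃, h₄⟩
    obtain rfl : x = x' := h₁
    obtain rfl : y' = y'' := h₂
    obtain rfl : y' = y := h₄
    exact h₃
  · exact fun h => ⟨(x, y, y), ⟨rfl, rfl⟩, h, rfl⟩

end Relations

section Factors

variable {E H X : Type*} [NormedAddCommGroup E] [NormedSpace ℝ E] [TopologicalSpace H]
  {I : ModelWithCorners ℝ E H} [TopologicalSpace X] [ChartedSpace H X]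
variable {F K Y : Type*} [NormedAddCommGroup F] [NormedSpace ℝ F] [TopologicalSpace K]
  {J : ModelWithCorners ℝ F K} [TopologicalSpace Y] [ChartedSpace K Y]

theorem base_mem_of_mem_tangentSetAt {S : Set X} {p : X} {v : E}
    (h : v ∈ tangentSetAt I S p) : p ∈ S := by
  obtain ⟨γ, hγ, hS⟩ := mem_tangentSetAt_iff.1 h
  exact hγ.base ▸ hS.self_of_nhds

theorem zero_mem_tangentSetAt {S : Set X} {p : X} (h : p ∈ S) : (0 : E) ∈ tangentSetAt I S p :=
  mem_tangentSetAt_iff.2 ⟨_, hasVelocity_const p, Filter.Eventually.of_forall fun _ => h⟩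

theorem mem_tangentSetAt_inv {f : SetRel X Y} {x : X} {y : Y} {a : E} {b : F} :
    ((b, a) : F × E) ∈ tangentSetAt (J.prod I) f.inv (y, x) ↔
      ((a, b) : E × F) ∈ tangentSetAt (I.prod J) f (x, y) := by
  constructor
  · intro h
    obtain ⟨γ, hγ, hS⟩ := mem_tangentSetAt_iff.1 h
    exact mem_tangentSetAt_iff.2 ⟨_, hγ.snd.prodMk hγ.fst, hS⟩
  · intro h
    obtain ⟨γ, hγ, hS⟩ := mem_tangentSetAt_iff.1 h
    exact mem_tangentSetAt_iff.2 ⟨_, hγ.snd.prodMk hγ.fst, hS⟩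

theorem prod_mem_tangentSetAt {S : Set X} {T : Set Y} {x : X} {y : Y} {a : E} {b : F}
    (ha : a ∈ tangentSetAt I S x) (hb : b ∈ tangentSetAt J T y) :
    ((a, b) : E × F) ∈ tangentSetAt (I.prod J) (S ×ˢ T) (x, y) := by
  obtain ⟨γ, hγ, hS⟩ := mem_tangentSetAt_iff.1 ha
  obtain ⟨δ, hδ, hT⟩ := mem_tangentSetAt_iff.1 hb
  exact mem_tangentSetAt_iff.2 ⟨_, hγ.prodMk hδ, hS.and hT⟩

theorem mem_tangentSetAt_idProdEpsilon [I.Boundaryless] [IsManifold I ∞ X] [J.Boundaryless]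
    [IsManifold J ∞ Y] {p : X × X × Y × Y} {v : E × E × F × F} :
    v ∈ tangentSetAt (I.prod (I.prod (J.prod J))) (idProdEpsilon X Y) p ↔
      p ∈ idProdEpsilon X Y ∧ v.1 = v.2.1 ∧ v.2.2.1 = v.2.2.2 := by
  constructor
  · intro h
    refine ⟨base_mem_of_mem_tangentSetAt h, ?_⟩
    obtain ⟨γ, hγ, hS⟩ := mem_tangentSetAt_iff.1 h
    exact ⟨hγ.fst.unique hγ.snd.fst (hS.mono fun t ht => ht.1),
      hγ.snd.snd.fst.unique hγ.snd.snd.snd (hS.mono fun t ht => ht.2)⟩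
  · obtain ⟨x, x', y, y'⟩ := p
    obtain ⟨a, a', b, b'⟩ := v
    rintro ⟨⟨hx, hy⟩, ha, hb⟩
    obtain rfl : x = x' := hx
    obtain rfl : y = y' := hy
    obtain rfl : a = a' := ha
    obtain rfl : b = b' := hb
    obtain ⟨γ, hγ, -⟩ := exists_hasVelocity (I := I) x a
    obtain ⟨δ, hδ, -⟩ := exists_hasVelocity (I := J) y b
    exact mem_tangentSetAt_iff.2 ⟨_, hγ.prodMk (hγ.prodMk (hδ.prodMk hδ)),
      Filter.Eventually.of_forall fun t => ⟨rfl, rfl⟩⟩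

theorem mem_tangentSetAt_graphProdId [J.Boundaryless] [IsManifold J ∞ Y] {f : SetRel X Y}
    {p : (X × Y × Y) × Y} {v : (E × F × F) × F} :
    v ∈ tangentSetAt ((I.prod (J.prod J)).prod J) (graphProdId f) p ↔
      p ∈ graphProdId f ∧
        ((v.1.1, v.1.2.1) : E × F) ∈ tangentSetAt (I.prod J) f (p.1.1, p.1.2.1) ∧
        v.1.2.2 = v.2 := by
  constructor
  · intro h
    refine ⟨base_mem_of_mem_tangentSetAt h, ?_⟩
    obtain ⟨γ, hγ, hS⟩ := mem_tangentSetAt_iff.1 h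
    exact ⟨mem_tangentSetAt_iff.2 ⟨_, hγ.fst.fst.prodMk hγ.fst.snd.fst, hS.mono fun t ht => ht.1⟩,
      hγ.fst.snd.snd.unique hγ.snd (hS.mono fun t ht => ht.2)⟩
  · obtain ⟨⟨x, y, y'⟩, y''⟩ := p
    obtain ⟨⟨a, b, b'⟩, b''⟩ := v
    rintro ⟨⟨-, hy⟩, hab, hb⟩
    obtain rfl : y' = y'' := hy
    obtain rfl : b' = b'' := hb
    obtain ⟨γ, hγ, hS⟩ := mem_tangentSetAt_iff.1 hab
    obtain ⟨δ, hδ, -⟩ := exists_hasVelocity (I := J) y' b'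
    exact mem_tangentSetAt_iff.2 ⟨_, (hγ.fst.prodMk (hγ.snd.prodMk hδ)).prodMk hδ,
      hS.mono fun t ht => ⟨ht, rfl⟩⟩

theorem mem_tangentSetAt_middleDiagonal [I.Boundaryless] [IsManifold I ∞ X]
    [J.Boundaryless] [IsManifold J ∞ Y]
    {E₂ H₂ Z : Type*} [NormedAddCommGroup E₂] [NormedSpace ℝ E₂] [TopologicalSpace H₂]
    {I₂ : ModelWithCorners ℝ E₂ H₂} [TopologicalSpace Z] [ChartedSpace H₂ Z] [I₂.Boundaryless]
    [IsManifold I₂ ∞ Z] (x : X) (y : Y) (z : Z) (a : E) (b : F) (c : E₂) :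
    (((a, b), (b, c)) : (E × F) × (F × E₂)) ∈
      tangentSetAt ((I.prod J).prod (J.prod I₂)) (middleDiagonal X Y Z) ((x, y), (y, z)) := by
  obtain ⟨γ, hγ, -⟩ := exists_hasVelocity (I := I) x a
  obtain ⟨δ, hδ, -⟩ := exists_hasVelocity (I := J) y b
  obtain ⟨ε, hε, -⟩ := exists_hasVelocity (I := I₂) z c
  exact mem_tangentSetAt_iff.2 ⟨_, (hγ.prodMk hδ).prodMk (hδ.prodMk hε),
    Filter.Eventually.of_forall fun t => rfl⟩

theorem exists_hasVelocity_hasDerivAt [I.Boundaryless] [IsManifold I ∞ X] (p : X) (v : E) :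
    ∃ γ : ℝ → X, (∃ u, HasVelocity I γ p u) ∧
      HasDerivAt (fun t => extChartAt I p (γ t)) v 0 := by
  obtain ⟨γ, hγ, h⟩ := exists_hasVelocity (I := I) p v
  refine ⟨γ, ⟨v, hγ⟩, HasDerivAt.congr_of_eventuallyEq ?_ h⟩
  simpa using ((hasDerivAt_id (0 : ℝ)).smul_const v).const_add (extChartAt I p p)

section Smooth

variable [FiniteDimensional ℝ F] [J.Boundaryless] [T2Space Y] [IsManifold J ∞ Y]

theorem isSmoothRel_graphProdId [I.Boundaryless] [IsManifold I ∞ X]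
    {f : SetRel X Y} (hf : IsSmoothRel I J f) :
    IsSmoothRel (I.prod (J.prod J)) J (graphProdId f) := by
  refine IsClosedSubmanifold.preimage_inter_eq (J := J) hf
    (π := fun p : (X × Y × Y) × Y => (p.1.1, p.1.2.1)) (α := fun p => p.1.2.2)
    (β := fun p => p.2) ?_ ?_ ?_ ?_
  · exact (contMDiff_fst.comp contMDiff_fst).prodMk
      (contMDiff_fst.comp (contMDiff_snd.comp contMDiff_fst))
  · exact contMDiff_snd.comp (contMDiff_snd.comp contMDiff_fst)
  · exact contMDiff_snd
  · rintro ⟨⟨x, y, y'⟩, y''⟩ - - ⟨a, b⟩ w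
    obtain ⟨γ, hγ, -⟩ := exists_hasVelocity (I := I) x a
    obtain ⟨δ, hδ, -⟩ := exists_hasVelocity (I := J) y b
    obtain ⟨ε, ⟨u, hε⟩, hw⟩ := exists_hasVelocity_hasDerivAt (I := J) y' w
    exact ⟨_, _, (hγ.prodMk (hδ.prodMk hε)).prodMk (hasVelocity_const y''), hγ.prodMk hδ, hw,
      fun _ => rfl⟩

theorem isSmoothRel_graphProdId_inv [I.Boundaryless] [IsManifold I ∞ X]
    {f : SetRel X Y} (hf : IsSmoothRel I J f) :
    IsSmoothRel J (I.prod (J.prod J)) (graphProdId f).inv := by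
  refine IsClosedSubmanifold.preimage_inter_eq (J := J) hf
    (π := fun p : Y × (X × Y × Y) => (p.2.1, p.2.2.1)) (α := fun p => p.2.2.2)
    (β := fun p => p.1) ?_ ?_ ?_ ?_
  · exact (contMDiff_fst.comp contMDiff_snd).prodMk
      (contMDiff_fst.comp (contMDiff_snd.comp contMDiff_snd))
  · exact contMDiff_snd.comp (contMDiff_snd.comp contMDiff_snd)
  · exact contMDiff_fst
  · rintro ⟨y'', x, y, y'⟩ - - ⟨a, b⟩ w
    obtain ⟨γ, hγ, -⟩ := exists_hasVelocity (I := I) x a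
    obtain ⟨δ, hδ, -⟩ := exists_hasVelocity (I := J) y b
    obtain ⟨ε, ⟨u, hε⟩, hw⟩ := exists_hasVelocity_hasDerivAt (I := J) y' w
    exact ⟨_, _, (hasVelocity_const y'').prodMk (hγ.prodMk (hδ.prodMk hε)), hγ.prodMk hδ, hw,
      fun _ => rfl⟩

theorem isSmoothRel_idProdEpsilon [FiniteDimensional ℝ E] [I.Boundaryless] [T2Space X]
    [IsManifold I ∞ X] : IsSmoothRel I (I.prod (J.prod J)) (idProdEpsilon X Y) := by
  have h := IsClosedSubmanifold.preimage_inter_eq (J := I.prod J)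
    (I' := I.prod (I.prod (J.prod J)))
    (isClosedSubmanifold_univ (I := 𝓘(ℝ, Fin 0 → ℝ)) (M := Fin 0 → ℝ))
    (π := fun _ : X × X × Y × Y => 0) (α := fun p => (p.1, p.2.2.1))
    (β := fun p => (p.2.1, p.2.2.2)) contMDiff_const ?_ ?_ ?_
  · have he : idProdEpsilon X Y = {n | (0 : Fin 0 → ℝ) ∈ Set.univ ∧
        (n.1, n.2.2.1) = (n.2.1, n.2.2.2)} := by
      ext p
      simp [mem_idProdEpsilon]
    exact he ▸ h
  · exact contMDiff_fst.prodMk (contMDiff_fst.comp (contMDiff_snd.comp contMDiff_snd))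
  · exact (contMDiff_fst.comp contMDiff_snd).prodMk
      (contMDiff_snd.comp (contMDiff_snd.comp contMDiff_snd))
  · rintro ⟨x, x', y, y'⟩ - - v ⟨a, b⟩
    obtain ⟨γ, ⟨u, hγ⟩, ha⟩ := exists_hasVelocity_hasDerivAt (I := I) x a
    obtain ⟨δ, ⟨u', hδ⟩, hb⟩ := exists_hasVelocity_hasDerivAt (I := J) y b
    refine ⟨fun t => (γ t, x', δ t, y'), _,
      hγ.prodMk ((hasVelocity_const x').prodMk (hδ.prodMk (hasVelocity_const y'))), ?_, ?_,
      fun _ => rfl⟩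
    · rw [Subsingleton.elim v 0]
      exact hasVelocity_const _
    · simp only [extChartAt_prod]
      exact ha.prodMk hb

end Smooth

section Main

variable [I.Boundaryless] [IsManifold I ∞ X]
  [FiniteDimensional ℝ F] [J.Boundaryless] [T2Space Y] [IsManifold J ∞ Y]

theorem isCanonicalRel_idProdEpsilon [FiniteDimensional ℝ E] [T2Space X]
    {ωX : TwoForm I X} (hX : IsSymplectic I ωX)
    {ωY : TwoForm J Y} (hY : IsSymplectic J ωY) :
    IsCanonicalRel I (I.prod (J.prod J)) ωX (ωX.prod (ωY.dual.prod ωY)) (idProdEpsilon X Y) := by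
  refine ⟨isSmoothRel_idProdEpsilon, isLagrangian_iff.2 ?_⟩
  rintro ⟨x, x', y, y'⟩ hp ⟨a, a', b, b'⟩
  simp only [mem_tangentSetAt_idProdEpsilon, hp, true_and, TwoForm.pairing_prod,
    TwoForm.pairing_dual]
  obtain ⟨h₁, h₂⟩ := hp
  obtain rfl : x = x' := h₁
  obtain rfl : y = y' := h₂
  constructor
  · rintro ⟨rfl, rfl⟩ ⟨c, c', d, d'⟩ ⟨hc, hd⟩
    dsimp only at hc hd ⊢
    rw [hc, hd]
    ring
  · intro h
    constructor
    · refine sub_eq_zero.1 (hX.eq_zero x _ fun w => ?_)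
      have := h (w, w, 0, 0) ⟨rfl, rfl⟩
      simp only [TwoForm.pairing_zero_right] at this
      rw [TwoForm.pairing_sub_left]
      linarith
    · refine sub_eq_zero.1 (hY.eq_zero y _ fun w => ?_)
      have := h (0, 0, w, w) ⟨rfl, rfl⟩
      simp only [TwoForm.pairing_zero_right] at this
      rw [TwoForm.pairing_sub_left]
      linarith

theorem isCanonicalRel_graphProdId {ωX : TwoForm I X} {ωY : TwoForm J Y}
    (hY : IsSymplectic J ωY) {f : SetRel X Y} (hf : IsCanonicalRel I J ωX ωY f) :
    IsCanonicalRel (I.prod (J.prod J)) J (ωX.prod (ωY.dual.prod ωY)) ωY (graphProdId f) := by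
  refine ⟨isSmoothRel_graphProdId hf.smooth, isLagrangian_iff.2 ?_⟩
  have hL := isLagrangian_iff.1 hf.lagrangian
  rintro ⟨⟨x, y, y'⟩, y''⟩ hp ⟨⟨a, b, c⟩, d⟩
  have hL := hL (x, y) hp.1 (a, b)
  simp only [TwoForm.pairing_prod, TwoForm.pairing_dual] at hL
  simp only [mem_tangentSetAt_graphProdId, hp, true_and, TwoForm.pairing_prod,
    TwoForm.pairing_dual]
  obtain ⟨hxy, h₂⟩ := hp
  obtain rfl : y' = y'' := h₂
  constructor
  · rintro ⟨hab, rfl⟩ ⟨⟨a', b', c'⟩, d'⟩ ⟨hab', hc⟩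
    have := hL.1 hab (a', b') hab'
    dsimp only at hc this ⊢
    rw [hc]
    linarith
  · intro h
    constructor
    · refine hL.2 fun w hw => ?_
      have := h ((w.1, w.2, 0), 0) ⟨hw, rfl⟩
      simp only [TwoForm.pairing_zero_right] at this
      linarith
    · refine sub_eq_zero.1 (hY.eq_zero y' _ fun w => ?_)
      have := h ((0, 0, w), w) ⟨zero_mem_tangentSetAt (I := I.prod J) hxy, rfl⟩
      simp only [TwoForm.pairing_zero_right] at this
      rw [TwoForm.pairing_sub_left]
      linarith

end Main

end Factors
end CanRel

namespace CanRel

section Reductions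

variable {E H X : Type*} [NormedAddCommGroup E] [NormedSpace ℝ E] [TopologicalSpace H]
  {I : ModelWithCorners ℝ E H} [TopologicalSpace X] [ChartedSpace H X]
variable {F K Y : Type*} [NormedAddCommGroup F] [NormedSpace ℝ F] [TopologicalSpace K]
  {J : ModelWithCorners ℝ F K} [TopologicalSpace Y] [ChartedSpace K Y]

theorem mk_mem_tangentRel {f : SetRel X Y} {x : X} {y : Y} {a : E} {b : F} :
    ((⟨x, a⟩, ⟨y, b⟩) : TangentBundle I X × TangentBundle J Y) ∈ tangentRel I J f ↔
      ((a, b) : E × F) ∈ tangentSetAt (I.prod J) f (x, y) := Iff.rfl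

theorem isEmbeddingOntoClosedSubmanifold_of_leftInverse {N : Set X} {π : X → Y} {s : Y → X}
    (hπ : ContMDiff I J ∞ π) (hs : ContMDiff J I ∞ s) (h : ∀ p ∈ N, s (π p) = p)
    (himage : IsClosedSubmanifold J (π '' N)) : IsEmbeddingOntoClosedSubmanifold I J N π := by
  refine ⟨?_, ?_, himage⟩
  · refine Topology.IsEmbedding.of_comp (hπ.continuous.comp continuous_subtype_val) hs.continuous ?_
    convert Topology.IsEmbedding.subtypeVal (p := (· ∈ N)) using 1
    exact funext fun p => h p p.2
  · intro p hp
    have key : ∀ v ∈ tangentSetAt I N p,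
        v = (mfderiv J I s (π p) : F →L[ℝ] E) (mfderiv I J π p v) := by
      intro v hv
      obtain ⟨γ, hγ, hN⟩ := mem_tangentSetAt_iff.1 hv
      exact hγ.unique ((hγ.comp hπ.contMDiffAt).comp hs.contMDiffAt)
        (hN.mono fun t ht => (h _ ht).symm)
    intro v hv w hw hvw
    rw [key v hv, key w hw]
    exact congrArg (mfderiv J I s (π p) : F →L[ℝ] E) hvw

variable [I.Boundaryless] [IsManifold I ∞ X] [J.Boundaryless] [IsManifold J ∞ Y]

theorem isStronglyTransversal_factorization {f : SetRel X Y} (hf : IsSmoothRel I J f) :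
    IsStronglyTransversal I (I.prod (J.prod J)) J (idProdEpsilon X Y) (graphProdId f) := by
  refine ⟨?_, ?_⟩
  · rintro ⟨⟨x, x₁, y₁, y₂⟩, ⟨x₃, y₃, y₄⟩, y₅⟩ ⟨⟨h₁, h₂⟩, h₃⟩
      ⟨⟨a, a₁, b₁, b₂⟩, ⟨a₃, b₃, b₄⟩, b₅⟩
    have h₁' : x = x₁ ∧ y₁ = y₂ := h₁
    have h₂' : (x₃, y₃) ∈ f ∧ y₄ = y₅ := h₂
    have h₃' : (x₁, y₁, y₂) = (x₃, y₃, y₄) := h₃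
    simp only [Prod.mk.injEq] at h₃'
    obtain ⟨rfl, rfl⟩ := h₁'
    obtain ⟨rfl, rfl, rfl⟩ := h₃'
    obtain ⟨hf', rfl⟩ := h₂'
    refine ⟨((a₁ - a₃, a₁ - a₃, b₁ - b₃, b₁ - b₃),
        ((0, 0, b₄ - b₂ + (b₁ - b₃)), b₄ - b₂ + (b₁ - b₃))),
      prod_mem_tangentSetAt (I := I.prod (I.prod (J.prod J))) (J := (I.prod (J.prod J)).prod J)
        (mem_tangentSetAt_idProdEpsilon.2 ⟨⟨rfl, rfl⟩, rfl, rfl⟩)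
        (mem_tangentSetAt_graphProdId.2
          ⟨⟨hf', rfl⟩, zero_mem_tangentSetAt (I := I.prod J) hf', rfl⟩),
      ((a - (a₁ - a₃), (a₃, b₃, b₂ - (b₁ - b₃))), ((a₃, b₃, b₂ - (b₁ - b₃)),
        b₅ - (b₄ - b₂ + (b₁ - b₃)))),
      mem_tangentSetAt_middleDiagonal (I := I) (J := I.prod (J.prod J)) (I₂ := J) _ _ _ _ _ _, ?_⟩
    show ((a₁ - a₃ + (a - (a₁ - a₃)), (a₁ - a₃ + a₃, b₁ - b₃ + b₃, b₁ - b₃ + (b₂ - (b₁ - b₃)))),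
      ((0 + a₃, 0 + b₃, b₄ - b₂ + (b₁ - b₃) + (b₂ - (b₁ - b₃))),
        b₄ - b₂ + (b₁ - b₃) + (b₅ - (b₄ - b₂ + (b₁ - b₃))))) =
      (((a, a₁, b₁, b₂), (a₃, b₃, b₄), b₅) : (E × E × F × F) × (E × F × F) × F)
    ext <;> dsimp only <;> abel
  · refine isEmbeddingOntoClosedSubmanifold_of_leftInverse
      (s := fun q : X × Y => ((q.1, (q.1, q.2, q.2)), ((q.1, q.2, q.2), q.2))) ?_ ?_ ?_ ?_
    · exact (contMDiff_fst.comp contMDiff_fst).prodMk (contMDiff_snd.comp contMDiff_snd)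
    · have h : ContMDiff (I.prod J) (I.prod (J.prod J)) ∞
          (fun q : X × Y => (q.1, q.2, q.2)) :=
        contMDiff_fst.prodMk (contMDiff_snd.prodMk contMDiff_snd)
      exact (contMDiff_fst.prodMk h).prodMk (h.prodMk contMDiff_snd)
    · rintro ⟨⟨x, x₁, y₁, y₂⟩, ⟨x₃, y₃, y₄⟩, y₅⟩ ⟨⟨h₁, h₂⟩, h₃⟩
      have h₁' : x = x₁ ∧ y₁ = y₂ := h₁
      have h₂' : (x₃, y₃) ∈ f ∧ y₄ = y₅ := h₂
      have h₃' : (x₁, y₁, y₂) = (x₃, y₃, y₄) := h₃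
      simp only [Prod.mk.injEq] at h₃'
      obtain ⟨rfl, rfl⟩ := h₁'
      obtain ⟨rfl, rfl, rfl⟩ := h₃'
      obtain ⟨-, rfl⟩ := h₂'
      rfl
    · have : (fun p : (X × X × Y × Y) × (X × Y × Y) × Y => (p.1.1, p.2.2)) ''
          fibreProduct (idProdEpsilon X Y) (graphProdId f) =
          SetRel.comp (idProdEpsilon X Y) (graphProdId f) := by
        ext ⟨x, y⟩
        constructor
        · rintro ⟨⟨⟨x, q⟩, ⟨q', y⟩⟩, ⟨⟨h₁, h₂⟩, h₃⟩, h⟩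
          obtain rfl : q = q' := h₃
          obtain ⟨rfl, rfl⟩ := Prod.mk.inj h
          exact ⟨q, h₁, h₂⟩
        · rintro ⟨q, h₁, h₂⟩
          exact ⟨((x, q), (q, y)), ⟨⟨h₁, h₂⟩, rfl⟩, rfl⟩
      rw [this, comp_idProdEpsilon_graphProdId]
      exact hf

theorem isProperMap_snd_of_section [T2Space Y] {f : SetRel X Y} (hf : IsClosed f) {s : Y → X}
    (hs : Continuous s) (h : ∀ p ∈ f, s p.2 = p.1) : IsProperMap (fun p : f => p.1.2) := by
  refine isProperMap_of_comp_of_t2 (continuous_snd.comp continuous_subtype_val)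
    (hs.prodMk continuous_id) ?_
  convert hf.isClosedEmbedding_subtypeVal.isProperMap using 1
  exact funext fun p => Prod.ext (h p p.2) rfl

variable [T2Space X] [FiniteDimensional ℝ F] [T2Space Y]

theorem isReduction_idProdEpsilon [FiniteDimensional ℝ E] (h : Nonempty X → Nonempty Y) :
    IsReduction I (I.prod (J.prod J)) (idProdEpsilon X Y) := by
  refine ⟨isSmoothRel_idProdEpsilon, fun x => ?_, ?_, ?_, ?_, ?_⟩
  · obtain ⟨y⟩ := h ⟨x⟩
    exact ⟨(x, y, y), rfl, rfl⟩
  · rintro q x x' h₁ h₂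
    exact (mem_idProdEpsilon.1 h₁).1.trans (mem_idProdEpsilon.1 h₂).1.symm
  · rintro ⟨x, a⟩
    obtain ⟨y⟩ := h ⟨x⟩
    exact ⟨⟨(x, y, y), (a, 0, 0)⟩, mk_mem_tangentRel.2
      (mem_tangentSetAt_idProdEpsilon.2 ⟨⟨rfl, rfl⟩, rfl, rfl⟩)⟩
  · rintro ⟨q, c⟩ ⟨x, a⟩ ⟨x', a'⟩ h₁ h₂
    have h₁ := mem_tangentSetAt_idProdEpsilon.1 (mk_mem_tangentRel.1 h₁)
    have h₂ := mem_tangentSetAt_idProdEpsilon.1 (mk_mem_tangentRel.1 h₂)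
    obtain rfl : x = x' := h₁.1.1.trans h₂.1.1.symm
    exact congrArg (Bundle.TotalSpace.mk x) (h₁.2.1.trans h₂.2.1.symm)
  · exact isProperMap_snd_of_section
      (isSmoothRel_idProdEpsilon (I := I) (J := J)).1 continuous_fst fun p hp => hp.1.symm

theorem isCoreduction_graphProdId {f : SetRel X Y} (hf : IsSmoothRel I J f)
    (h : Nonempty Y → f.Nonempty) :
    IsCoreduction (I.prod (J.prod J)) J (graphProdId f) := by
  refine ⟨isSmoothRel_graphProdId_inv hf, fun y => ?_, ?_, ?_, ?_, ?_⟩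
  · obtain ⟨⟨x, y'⟩, hxy⟩ := h ⟨y⟩
    exact ⟨(x, y', y), hxy, rfl⟩
  · rintro q y y' h₁ h₂
    exact h₁.2.symm.trans h₂.2
  · rintro ⟨y, b⟩
    obtain ⟨⟨x, y'⟩, hxy⟩ := h ⟨y⟩
    exact ⟨⟨(x, y', y), (0, 0, b)⟩, mk_mem_tangentRel.2 (mem_tangentSetAt_inv.2
      (mem_tangentSetAt_graphProdId.2
        ⟨⟨hxy, rfl⟩, zero_mem_tangentSetAt (I := I.prod J) hxy, rfl⟩))⟩
  · rintro ⟨q, c⟩ ⟨y, b⟩ ⟨y', b'⟩ h₁ h₂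
    have h₁ := mem_tangentSetAt_graphProdId.1 (mem_tangentSetAt_inv.1 (mk_mem_tangentRel.1 h₁))
    have h₂ := mem_tangentSetAt_graphProdId.1 (mem_tangentSetAt_inv.1 (mk_mem_tangentRel.1 h₂))
    obtain rfl : y = y' := h₁.1.2.symm.trans h₂.1.2
    exact congrArg (Bundle.TotalSpace.mk y) (h₁.2.2.symm.trans h₂.2.2)
  · exact isProperMap_snd_of_section (isSmoothRel_graphProdId_inv hf).1
      (continuous_snd.comp continuous_snd) fun p hp => hp.2

end Reductions

end CanRel

theorem mainTheorem2
    {E H X : Type*} [NormedAddCommGroup E] [NormedSpace ℝ E] [FiniteDimensional ℝ E]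
    [TopologicalSpace H] (I : ModelWithCorners ℝ E H) [I.Boundaryless]
    [TopologicalSpace X] [T2Space X] [ChartedSpace H X] [IsManifold I ∞ X]
    {F K Y : Type*} [NormedAddCommGroup F] [NormedSpace ℝ F] [FiniteDimensional ℝ F]
    [TopologicalSpace K] (J : ModelWithCorners ℝ F K) [J.Boundaryless]
    [TopologicalSpace Y] [T2Space Y] [ChartedSpace K Y] [IsManifold J ∞ Y]
    (ωX : CanRel.TwoForm I X) (hX : CanRel.IsSymplectic I ωX)
    (ωY : CanRel.TwoForm J Y) (hY : CanRel.IsSymplectic J ωY)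
    (f : SetRel X Y) (hf : CanRel.IsCanonicalRel I J ωX ωY f) :
    -- the middle object `X × Ȳ × Y` is a symplectic manifold
    CanRel.IsSymplectic (I.prod (J.prod J)) (ωX.prod (ωY.dual.prod ωY)) ∧
    -- both factors are canonical relations
    CanRel.IsCanonicalRel I (I.prod (J.prod J)) ωX (ωX.prod (ωY.dual.prod ωY))
      (CanRel.idProdEpsilon X Y) ∧
    CanRel.IsCanonicalRel (I.prod (J.prod J)) J (ωX.prod (ωY.dual.prod ωY)) ωY
      (CanRel.graphProdId f) ∧
    -- they factor `f`
    SetRel.comp (CanRel.idProdEpsilon X Y) (CanRel.graphProdId f) = f ∧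
    CanRel.IsStronglyTransversal I (I.prod (J.prod J)) J
      (CanRel.idProdEpsilon X Y) (CanRel.graphProdId f) ∧
    -- the first factor is a reduction, unless `Y` is empty and `X` is not
    ((Nonempty X → Nonempty Y) →
      CanRel.IsReduction I (I.prod (J.prod J)) (CanRel.idProdEpsilon X Y)) ∧
    -- the second factor is a coreduction, unless `f` is empty and `Y` is not
    ((Nonempty Y → f.Nonempty) →
      CanRel.IsCoreduction (I.prod (J.prod J)) J (CanRel.graphProdId f)) := by
  exact ⟨hX.prod (hY.dual.prod hY), CanRel.isCanonicalRel_idProdEpsilon hX hY,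
    CanRel.isCanonicalRel_graphProdId hY hf, CanRel.comp_idProdEpsilon_graphProdId f,
    CanRel.isStronglyTransversal_factorization hf.smooth, CanRel.isReduction_idProdEpsilon,
    CanRel.isCoreduction_graphProdId hf.smooth⟩
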